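/- Let $n\ge 0$ and let $\mathcal H=\bigotimes_{a=1}^n\mathcal H_a$ with $\mathcal H_a=\mathbb C^{d_a}$ be the Hilbert space of a finite multipartite quantum system. Let $\mathcal N_1,\dots,\mathcal N_K\subseteq\{1,\dots,n\}$, $K\ge 1$, be the neighborhoods, and write $\mathcal H_{\mathcal N_j}=\bigotimes_{a\in\mathcal N_j}\mathcal H_a$, $\mathcal H_{\overline{\mathcal N}_j}=\bigotimes_{a\notin\mathcal N_j}\mathcal H_a$. A neighborhood map is a completely positive trace-preserving linear map $\mathcal E$ on $\mathcal B(\mathcal H)$ that for some $j$ has the form $\mathcal E=\mathcal E_{\mathcal N_j}\otimes\mathcal I_{\overline{\mathcal N}_j}$, with $\mathcal E_{\mathcal N_j}$ a linear map on $\mathcal B(\mathcal H_{\mathcal N_j})$ and $\mathcal I_{\overline{\mathcal N}_j}$ the identity on $\mathcal B(\mathcal H_{\overline{\mathcal N}_j})$. A density matrix $\rho$ on $\mathcal H$ is called discrete-time quasi-locally stabilizable (QLS) if there is a sequence $(\mathcal E_t)_{t\ge 0}$ of neighborhood maps such that the propagators $\mathcal E_{t,s}=\mathcal E_{t-1}\circ\cdots\circ\mathcal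 E_s$ (with $\mathcal E_{s,s}=\mathrm{id}$) satisfy $$\mathcal E_{t,s}(\rho)=\rho\quad\text{for all } t\ge s\ge 0,\qquad \lim_{t\to\infty}\|\mathcal E_{t,s}(\sigma)-\rho\|_1=0\quad\text{for all density matrices }\sigma\text{ on }\mathcal H\text{ and all } s\ge 0.$$ **Theorem.** Let $\psi\in\mathcal H$ be a unit vector, $\rho=|\psi\rangle\langle\psi|$, and let $\rho_{\mathcal N_j}=\mathrm{Tr}_{\overline{\mathcal N}_j}(\rho)$ be its reduced states. Then $\rho$ is discrete-time QLS if and only if $$\mathrm{supp}(\rho)=\bigcap_{j=1}^K\big(\mathrm{supp}(\rho_{\mathcal N_j})\otimes\mathcal H_{\overline{\mathcal N}_j}\big).$$ -/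

import Mathlib

noncomputable section

namespace QLS

open scoped ComplexOrder

/-- Labels of the product basis of `H = ⨂ₐ ℂ^(d a)`, where `d a` is the dimension of the `a`-th
of `n` subsystems. -/
abbrev Config {n : ℕ} (d : Fin n → ℕ) : Type := ∀ a : Fin n, Fin (d a)

/-- Labels of the product basis of `H_S = ⨂_{a ∈ S} ℂ^(d a)`. -/
abbrev InConfig {n : ℕ} (d : Fin n → ℕ) (S : Finset (Fin n)) : Type :=
  ∀ a : {a : Fin n // a ∈ S}, Fin (d a)

/-- Labels of the product basis of `⨂_{a ∉ S} ℂ^(d a)`. -/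
abbrev OutConfig {n : ℕ} (d : Fin n → ℕ) (S : Finset (Fin n)) : Type :=
  ∀ a : {a : Fin n // a ∉ S}, Fin (d a)

/-- The identification of `H` with `H_S ⊗ H_{Sᶜ}`, on the labels of the product bases. -/
def split {n : ℕ} (d : Fin n → ℕ) (S : Finset (Fin n)) :
    Config d ≃ InConfig d S × OutConfig d S :=
  Equiv.piEquivPiSubtypeProd (fun a => a ∈ S) (fun a => Fin (d a))

/-- Density matrices: positive semidefinite with trace one. -/
def IsDensity {m : Type*} [Fintype m] (ρ : Matrix m m ℂ) : Prop :=
  ρ.PosSemidef ∧ ρ.trace = 1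

/-- The operator `|ψ⟩⟨ψ|`. -/
def pureState {m : Type*} (ψ : m → ℂ) : Matrix m m ℂ :=
  Matrix.vecMulVec ψ (star ψ)

/-- The support of a Hermitian operator: its range, equivalently the orthogonal complement of its
kernel. -/
def supp {m : Type*} [Fintype m] (ρ : Matrix m m ℂ) : Submodule ℂ (m → ℂ) :=
  LinearMap.range ρ.mulVecLin

/-- The linear map `Φ ⊗ id` on operators of `ℂ^m ⊗ ℂ^e`: `Φ` is applied to each of the blocks
`(⟨x| on the second factor) X (|y⟩ on the second factor)`. -/
def ampliate {m : Type*} (e : Type*) (Φ : Matrix m m ℂ →ₗ[ℂ] Matrix m m ℂ) :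
    Matrix (m × e) (m × e) ℂ →ₗ[ℂ] Matrix (m × e) (m × e) ℂ where
  toFun X := Matrix.of fun p q => Φ (Matrix.of fun i j => X (i, p.2) (j, q.2)) p.1 q.1
  map_add' X Y := by
    ext p q
    exact congrFun (congrFun (Φ.map_add (Matrix.of fun i j => X (i, p.2) (j, q.2))
      (Matrix.of fun i j => Y (i, p.2) (j, q.2))) p.1) q.1
  map_smul' c X := by
    ext p q
    exact congrFun (congrFun (Φ.map_smul c (Matrix.of fun i j => X (i, p.2) (j, q.2))) p.1) q.1

/-- Completely positive and trace-preserving linear maps: `Φ ⊗ id_k` maps positive semidefinite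
operators to positive semidefinite operators for every `k`, and `Φ` preserves the trace. -/
structure IsCPTP {m : Type*} [Fintype m] (Φ : Matrix m m ℂ →ₗ[ℂ] Matrix m m ℂ) : Prop where
  completely_positive : ∀ (k : ℕ) (X : Matrix (m × Fin k) (m × Fin k) ℂ),
    X.PosSemidef → (ampliate (Fin k) Φ X).PosSemidef
  trace_preserving : ∀ X : Matrix m m ℂ, (Φ X).trace = X.trace

/-- The linear map `Φ ⊗ id` on operators of `H`, for `Φ` acting on operators of `H_S`. -/
def extendMap {n : ℕ} {d : Fin n → ℕ} (S : Finset (Fin n))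
    (Φ : Matrix (InConfig d S) (InConfig d S) ℂ →ₗ[ℂ] Matrix (InConfig d S) (InConfig d S) ℂ)
    (X : Matrix (Config d) (Config d) ℂ) : Matrix (Config d) (Config d) ℂ :=
  (ampliate (OutConfig d S) Φ (X.submatrix (split d S).symm (split d S).symm)).submatrix
    (split d S) (split d S)

/-- Neighborhood maps: CPTP maps of the form `Φ ⊗ id`, with `Φ` acting on one of the
neighborhoods. -/
def IsNeighborhoodMap {n K : ℕ} {d : Fin n → ℕ} (N : Fin K → Finset (Fin n))
    (E : Matrix (Config d) (Config d) ℂ →ₗ[ℂ] Matrix (Config d) (Config d) ℂ) : Prop :=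
  IsCPTP E ∧ ∃ (j : Fin K)
    (Φ : Matrix (InConfig d (N j)) (InConfig d (N j)) ℂ →ₗ[ℂ]
      Matrix (InConfig d (N j)) (InConfig d (N j)) ℂ), ∀ X, E X = extendMap (N j) Φ X

/-- `propagator E s k` is the evolution from time `s` to time `s + k`, that is
`E (s + k - 1) ∘ ⋯ ∘ E (s + 1) ∘ E s`, and the identity for `k = 0`. -/
def propagator {m : Type*} (E : ℕ → (Matrix m m ℂ →ₗ[ℂ] Matrix m m ℂ)) (s : ℕ) :
    ℕ → (Matrix m m ℂ →ₗ[ℂ] Matrix m m ℂ)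
  | 0 => LinearMap.id
  | k + 1 => E (s + k) ∘ₗ propagator E s k

/-- `ρ` is discrete-time quasi-locally stabilizable with respect to the neighborhoods `N`: there is
a sequence of neighborhood CPTP maps that leaves `ρ` invariant and whose propagators drive every
density matrix to `ρ` from every starting time. The limit is in the usual topology of matrices,
which is that of the trace norm and of any other norm. -/
def IsQLS {n K : ℕ} {d : Fin n → ℕ} (N : Fin K → Finset (Fin n))
    (ρ : Matrix (Config d) (Config d) ℂ) : Prop :=
  ∃ E : ℕ → (Matrix (Config d) (Config d) ℂ →ₗ[ℂ] Matrix (Config d) (Config d) ℂ),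
    (∀ t, IsNeighborhoodMap N (E t)) ∧
    (∀ s k, propagator E s k ρ = ρ) ∧
    (∀ σ, IsDensity σ → ∀ s,
      Filter.Tendsto (fun k => propagator E s k σ) Filter.atTop (nhds ρ))

/-- The reduced operator `ρ_S = Tr_{Sᶜ} ρ`. -/
def reducedState {n : ℕ} {d : Fin n → ℕ} (S : Finset (Fin n))
    (ρ : Matrix (Config d) (Config d) ℂ) : Matrix (InConfig d S) (InConfig d S) ℂ :=
  Matrix.of fun i j => ∑ x : OutConfig d S, ρ ((split d S).symm (i, x)) ((split d S).symm (j, x))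

/-- The subspace `V ⊗ H_{Sᶜ}` of `H`, for a subspace `V` of `H_S`: the span of the product vectors
`u ⊗ v` with `u ∈ V`. -/
def extendSubspace {n : ℕ} {d : Fin n → ℕ} (S : Finset (Fin n))
    (V : Submodule ℂ (InConfig d S → ℂ)) : Submodule ℂ (Config d → ℂ) :=
  Submodule.span ℂ {w | ∃ u ∈ V, ∃ v : OutConfig d S → ℂ,
    w = fun x => u (split d S x).1 * v (split d S x).2}

end QLS

end

noncomputable section

namespace QLS

open scoped ComplexOrder
open Matrix Filter Topology Kronecker

/-! Necessity. The blocks of `ψ` span the support of the reduced state. If `Φ ⊗ id` fixes `|ψ⟩⟨ψ|`,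
then `Φ` fixes `|u⟩⟨v|` for all blocks `u`, `v`, hence by sesquilinearity for all `u`, `v` in that
support (`extendMap_pureState_eq_self`). A unit vector in the intersection is therefore a state that
no map of the sequence moves, and convergence forces it to be `|ψ⟩⟨ψ|`.

Sufficiency. Cycle through the neighborhoods with a lazy cooling map: with weight 1/2 do nothing,
otherwise measure the projection `P j` onto the support of the reduced state and, on failure, reset
the neighborhood to the maximally mixed state. This fixes `|ψ⟩⟨ψ|` and never lowers the fidelity
with `ψ`. Vectors with zero fidelity after `k` periods form decreasing subspaces, whose intersection
`W` avoids `ψ` and is invariant under the operators `|a⟩⟨b|(1 - P j)`.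

Such a `W` vanishes (`eq_bot_of_invariant`). Otherwise take `S` maximal with `H_S ⊗ x ⊆ W`, `x ≠ 0`.
A failed measurement on some `N j ⊄ S` would enlarge `S` (`ContainsFactor.union`), so `H_S ⊗ x`
meets the support condition for those `j`. A slice `φ` of `ψ` on `S` makes `φ ⊗ x` meet it for `N j
⊆ S` as well. So `φ ⊗ x` is a nonzero multiple of `ψ` lying in `W`, a contradiction.

Finite dimension and compactness then give `k` and `ε > 0` with fidelity at least `ε‖v‖²` after `k`
periods. Since cross terms with `ψ` vanish (`le_of_fidelity_le`), every `k` periods shrink the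
infidelity by a factor `1 - ε`. -/

/-! ### Pure states and fidelity -/

/-- The fidelity `⟨ψ|X|ψ⟩` with a pure state, as a real linear functional. -/
def fidelity {m : Type*} [Fintype m] (ψ : m → ℂ) : Matrix m m ℂ →ₗ[ℝ] ℝ where
  toFun X := (star ψ ⬝ᵥ X *ᵥ ψ).re
  map_add' X Y := by simp [Matrix.add_mulVec, dotProduct_add]
  map_smul' c X := by simp [Matrix.smul_mulVec, dotProduct_smul]

theorem fidelity_nonneg {m : Type*} [Fintype m] (ψ : m → ℂ) {X : Matrix m m ℂ}
    (hX : X.PosSemidef) : 0 ≤ fidelity ψ X :=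
  hX.re_dotProduct_nonneg ψ

theorem fidelity_pureState {m : Type*} [Fintype m] (ψ v : m → ℂ) :
    fidelity ψ (pureState v) = ‖star ψ ⬝ᵥ v‖ ^ 2 := by
  have h : star v ⬝ᵥ ψ = star (star ψ ⬝ᵥ v) := star_dotProduct v ψ
  simp only [fidelity, pureState, LinearMap.coe_mk, AddHom.coe_mk, vecMulVec_mulVec,
    dotProduct_smul, h]
  rw [← Complex.normSq_eq_norm_sq]
  simp [Complex.normSq_apply]

theorem posSemidef_pureState {m : Type*} [Fintype m] (v : m → ℂ) : (pureState v).PosSemidef :=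
  posSemidef_vecMulVec_self_star v

theorem trace_pureState {m : Type*} [Fintype m] (v : m → ℂ) :
    (pureState v).trace = ((∑ i, ‖v i‖ ^ 2 : ℝ) : ℂ) := by
  simp only [pureState, trace, diag_apply, vecMulVec_apply, Pi.star_apply, Complex.ofReal_sum]
  refine Finset.sum_congr rfl fun i _ => ?_
  simp [Complex.mul_conj, Complex.normSq_eq_norm_sq]

theorem mul_pureState_mul_conjTranspose {m : Type*} [Fintype m] (A : Matrix m m ℂ) (v : m → ℂ) :
    A * pureState v * Aᴴ = pureState (A *ᵥ v) := by
  simp [pureState, mul_vecMulVec, vecMulVec_mul, star_mulVec]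

theorem pureState_smul {m : Type*} (c : ℂ) (v : m → ℂ) :
    pureState (c • v) = (‖c‖ ^ 2 : ℝ) • pureState v := by
  ext i j
  simp only [pureState, vecMulVec_apply, Pi.smul_apply, Pi.star_apply, smul_eq_mul, star_mul',
    Matrix.smul_apply, Complex.real_smul]
  rw [← Complex.normSq_eq_norm_sq, Complex.normSq_eq_conj_mul_self]
  simp only [RCLike.star_def]
  ring

theorem exists_sum_pureState {m : Type*} [Fintype m] {X : Matrix m m ℂ}
    (hX : X.PosSemidef) : ∃ (r : ℕ) (v : Fin r → m → ℂ), X = ∑ i, pureState (v i) :=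
  posSemidef_iff_eq_sum_vecMulVec.1 hX

/-! ### Domination up to a positive constant -/

/-- `A` dominates a positive multiple of `B`. -/
def Dominates {m : Type*} (A B : Matrix m m ℂ) : Prop :=
  ∃ c : ℝ, 0 < c ∧ (A - c • B).PosSemidef

theorem Dominates.trans {m : Type*} {A B C : Matrix m m ℂ} (h₁ : Dominates A B)
    (h₂ : Dominates B C) : Dominates A C := by
  obtain ⟨a, ha, h₁⟩ := h₁
  obtain ⟨b, hb, h₂⟩ := h₂
  refine ⟨a * b, by positivity, ?_⟩
  have := h₁.add (h₂.smul (a := a) ha.le)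
  rwa [smul_sub, sub_add_sub_cancel, smul_smul] at this

theorem Dominates.refl {m : Type*} [Fintype m] (A : Matrix m m ℂ) : Dominates A A :=
  ⟨1, one_pos, by simpa using PosSemidef.zero⟩

/-- Linear maps that preserve positive semidefiniteness. -/
def IsPositive {m : Type*} (T : Matrix m m ℂ →ₗ[ℂ] Matrix m m ℂ) : Prop :=
  ∀ X, X.PosSemidef → (T X).PosSemidef

theorem Dominates.map {m : Type*} {A B : Matrix m m ℂ} (h : Dominates A B)
    {T : Matrix m m ℂ →ₗ[ℂ] Matrix m m ℂ} (hT : IsPositive T) : Dominates (T A) (T B) := by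
  obtain ⟨a, ha, h⟩ := h
  refine ⟨a, ha, ?_⟩
  have := hT _ h
  rwa [map_sub, LinearMap.map_smul_of_tower] at this

/-- Domination forgets constants, which is harmless here because only the vanishing of fidelities is
tracked through it. -/
theorem Dominates.fidelity_eq_zero {m : Type*} [Fintype m] {A B : Matrix m m ℂ}
    (h : Dominates A B) (hB : B.PosSemidef) {ψ : m → ℂ} (hA : fidelity ψ A = 0) :
    fidelity ψ B = 0 := by
  obtain ⟨a, ha, h⟩ := h
  have h1 := fidelity_nonneg ψ h
  have h2 := fidelity_nonneg ψ hB
  rw [map_sub, map_smul, hA, smul_eq_mul] at h1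
  nlinarith

/-! ### Fidelity estimates -/

/-- Density matrices whose fidelity with `ψ` is close to one are close to `|ψ⟩⟨ψ|`. -/
theorem sum_norm_sub_pureState_le {m : Type*} [Fintype m] {ψ : m → ℂ}
    (hψ : ∑ x, ‖ψ x‖ ^ 2 = 1) {σ : Matrix m m ℂ} (hσ : IsDensity σ) :
    ∑ i, ∑ j, ‖(σ - pureState ψ) i j‖ ^ 2 ≤ 2 * (1 - fidelity ψ σ) := by
  obtain ⟨r, v, hv⟩ := exists_sum_pureState hσ.1
  have htr : ∑ k, ∑ i, ‖v k i‖ ^ 2 = 1 := by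
    have := hσ.2
    rw [hv, trace_sum] at this
    simp only [trace_pureState] at this
    exact_mod_cast this
  -- The purity `Tr σ²` is at most one, by Cauchy–Schwarz on the entries of `∑ k, |v k⟩⟨v k|`.
  have hnorm : ∑ i, ∑ j, ‖σ i j‖ ^ 2 ≤ 1 := by
    have hij : ∀ i j, ‖σ i j‖ ^ 2 ≤ (∑ k, ‖v k i‖ ^ 2) * ∑ k, ‖v k j‖ ^ 2 := by
      intro i j
      have h1 : ‖σ i j‖ ≤ ∑ k, ‖v k i‖ * ‖v k j‖ := by
        rw [hv, Matrix.sum_apply]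
        refine (norm_sum_le _ _).trans (Finset.sum_le_sum fun k _ => ?_)
        simp [pureState, vecMulVec_apply]
      exact (pow_le_pow_left₀ (norm_nonneg _) h1 2).trans (Finset.sum_mul_sq_le_sq_mul_sq _ _ _)
    calc ∑ i, ∑ j, ‖σ i j‖ ^ 2 ≤ ∑ i, ∑ j, (∑ k, ‖v k i‖ ^ 2) * ∑ k, ‖v k j‖ ^ 2 :=
          Finset.sum_le_sum fun i _ => Finset.sum_le_sum fun j _ => hij i j
      _ = (∑ i, ∑ k, ‖v k i‖ ^ 2) * ∑ j, ∑ k, ‖v k j‖ ^ 2 := (Finset.sum_mul_sum _ _ _ _).symm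
      _ = 1 := by rw [Finset.sum_comm, htr, one_mul]
  have hF : fidelity ψ σ = ∑ i, ∑ j, (σ i j * star (pureState ψ i j)).re := by
    simp only [fidelity, LinearMap.coe_mk, AddHom.coe_mk, dotProduct, mulVec, Finset.mul_sum,
      Complex.re_sum]
    refine Finset.sum_congr rfl fun i _ => Finset.sum_congr rfl fun j _ => congrArg _ ?_
    simp only [pureState, vecMulVec_apply, Pi.star_apply, star_mul', star_star]
    ring
  have hρ : ∑ i, ∑ j, ‖pureState ψ i j‖ ^ 2 = 1 := by
    simp only [pureState, vecMulVec_apply, Pi.star_apply, norm_mul, norm_star, mul_pow]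
    rw [← Finset.sum_mul_sum, hψ, one_mul]
  have hsub : ∀ i j, ‖(σ - pureState ψ) i j‖ ^ 2 =
      ‖σ i j‖ ^ 2 + ‖pureState ψ i j‖ ^ 2 - 2 * (σ i j * star (pureState ψ i j)).re := by
    intro i j
    simp only [Matrix.sub_apply, ← Complex.normSq_eq_norm_sq, Complex.normSq_sub]
    rfl
  simp only [hsub, Finset.sum_sub_distrib, Finset.sum_add_distrib, ← Finset.mul_sum, hρ, ← hF]
  linarith

theorem fidelity_le_one {m : Type*} [Fintype m] {ψ : m → ℂ}
    (hψ : ∑ x, ‖ψ x‖ ^ 2 = 1) {σ : Matrix m m ℂ} (hσ : IsDensity σ) : fidelity ψ σ ≤ 1 := by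
  have h := sum_norm_sub_pureState_le hψ hσ
  have : 0 ≤ ∑ i, ∑ j, ‖(σ - pureState ψ) i j‖ ^ 2 := by positivity
  linarith

theorem tendsto_of_fidelity_tendsto {m : Type*} [Fintype m] {ψ : m → ℂ}
    (hψ : ∑ x, ‖ψ x‖ ^ 2 = 1) {σ : ℕ → Matrix m m ℂ} (hσ : ∀ k, IsDensity (σ k))
    (h : Tendsto (fun k => fidelity ψ (σ k)) atTop (𝓝 1)) :
    Tendsto σ atTop (𝓝 (pureState ψ)) := by
  refine tendsto_pi_nhds.2 fun i => tendsto_pi_nhds.2 fun j => ?_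
  rw [tendsto_iff_norm_sub_tendsto_zero]
  have h0 : Tendsto (fun k => √(2 * (1 - fidelity ψ (σ k)))) atTop (𝓝 0) := by
    have := ((tendsto_const_nhds (x := (1 : ℝ))).sub h).const_mul 2
    simpa using this.sqrt
  refine squeeze_zero (fun _ => norm_nonneg _) (fun k => Real.le_sqrt_of_sq_le ?_) h0
  refine le_trans ?_ (sum_norm_sub_pureState_le hψ (hσ k))
  refine le_trans ?_ (Finset.single_le_sum (fun i _ => Finset.sum_nonneg fun j _ => by positivity)
    (Finset.mem_univ i))
  exact Finset.single_le_sum (f := fun j => ‖(σ k - pureState ψ) i j‖ ^ 2)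
    (fun j _ => by positivity) (Finset.mem_univ j)

theorem pureState_add_smul {m : Type*} (u w : m → ℂ) (t : ℝ) :
    pureState ((t : ℂ) • u + w) =
      (t ^ 2) • pureState u + t • (vecMulVec u (star w) + vecMulVec w (star u)) + pureState w := by
  ext i j
  simp only [pureState, vecMulVec_apply, Pi.add_apply, Pi.smul_apply, Pi.star_apply, smul_eq_mul,
    star_add, star_mul', Matrix.add_apply, Matrix.smul_apply, Complex.real_smul, RCLike.star_def,
    Complex.conj_ofReal]
  push_cast
  ring

/-- A real functional that is at least `⟨ψ|·|ψ⟩` on pure states and agrees with it on `ψ` has no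
cross terms between `ψ` and its orthogonal complement. -/
theorem le_of_fidelity_le {m : Type*} [Fintype m] {ψ : m → ℂ} (hψ : ∑ x, ‖ψ x‖ ^ 2 = 1)
    {f : Matrix m m ℂ →ₗ[ℝ] ℝ} (hf : ∀ v, fidelity ψ (pureState v) ≤ f (pureState v))
    (hfψ : f (pureState ψ) = 1) {ε : ℝ} (hε : ∀ v, ε * ∑ i, ‖v i‖ ^ 2 ≤ f (pureState v))
    (v : m → ℂ) :
    ‖star ψ ⬝ᵥ v‖ ^ 2 + ε * (∑ i, ‖v i‖ ^ 2 - ‖star ψ ⬝ᵥ v‖ ^ 2) ≤ f (pureState v) := by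
  have hψψ : star ψ ⬝ᵥ ψ = 1 := by
    have := trace_pureState ψ
    rw [hψ, pureState, trace_vecMulVec, dotProduct_comm] at this
    simpa using this
  set c := star ψ ⬝ᵥ v with hc
  set w := v - c • ψ with hw
  have hψw : star ψ ⬝ᵥ w = 0 := by
    simp [hw, dotProduct_sub, dotProduct_smul, hψψ, hc]
  have hfc : f (pureState (c • ψ)) = ‖c‖ ^ 2 := by
    rw [pureState_smul, map_smul, hfψ, smul_eq_mul, mul_one]
  set l := f (vecMulVec (c • ψ) (star w) + vecMulVec w (star (c • ψ))) with hl
  -- On `t c ψ + w` the quadratic terms in `t` cancel, leaving an affine function of `t` that is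
  -- bounded below.
  have key : ∀ t : ℝ, 0 ≤ t * l + f (pureState w) := by
    intro t
    have h := hf ((t : ℂ) • (c • ψ) + w)
    rw [fidelity_pureState, dotProduct_add, hψw, dotProduct_smul, dotProduct_smul, hψψ,
      pureState_add_smul, map_add, map_add, map_smul, map_smul, hfc, ← hl] at h
    simp only [smul_eq_mul, mul_one, add_zero, norm_mul, Complex.norm_real, Real.norm_eq_abs,
      mul_pow, sq_abs] at h
    linarith
  have hl0 : l = 0 := by
    by_contra hne
    -- This `t` would make the affine function equal to `-1`.
    have h := key (-(f (pureState w) + 1) / l)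
    rw [div_mul_cancel₀ _ hne] at h
    linarith
  have hv : f (pureState v) = ‖c‖ ^ 2 + f (pureState w) := by
    have : v = ((1 : ℝ) : ℂ) • (c • ψ) + w := by simp [hw]
    rw [this, pureState_add_smul, map_add, map_add, map_smul, map_smul, hfc, ← hl, hl0]
    simp
  have hnorm : ∑ i, ‖v i‖ ^ 2 = ‖c‖ ^ 2 + ∑ i, ‖w i‖ ^ 2 := by
    have e : ∀ u : m → ℂ, ((∑ i, ‖u i‖ ^ 2 : ℝ) : ℂ) = star u ⬝ᵥ u := fun u => by
      rw [← trace_pureState, pureState, trace_vecMulVec, dotProduct_comm]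
    have hwψ : star w ⬝ᵥ ψ = 0 := by rw [star_dotProduct, hψw, star_zero]
    have hv' : v = c • ψ + w := by simp [hw]
    have : ((∑ i, ‖v i‖ ^ 2 : ℝ) : ℂ) = ((‖c‖ ^ 2 + ∑ i, ‖w i‖ ^ 2 : ℝ) : ℂ) := by
      rw [Complex.ofReal_add, e, e]
      conv_lhs => rw [hv']
      simp only [star_add, star_smul, add_dotProduct, dotProduct_add, smul_dotProduct,
        dotProduct_smul, hψψ, hψw, hwψ, smul_eq_mul, mul_zero, add_zero, zero_add, mul_one]
      rw [← Complex.normSq_eq_norm_sq, Complex.normSq_eq_conj_mul_self]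
      simp [mul_comm]
    exact_mod_cast this
  rw [hv, hnorm]
  have := hε w
  linarith

/-! ### Null spaces of positive functionals -/

/-- The vectors on whose pure states a positive functional vanishes. -/
def nullSpace {m : Type*} [Fintype m] (f : Matrix m m ℂ →ₗ[ℝ] ℝ)
    (hf : ∀ X, X.PosSemidef → 0 ≤ f X) : Submodule ℂ (m → ℂ) where
  carrier := {w | f (pureState w) = 0}
  zero_mem' := by
    have : pureState (0 : m → ℂ) = 0 := by simp [pureState]
    simp [this]
  smul_mem' c w hw := by
    simp only [Set.mem_ofPred_eq] at hw ⊢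
    rw [pureState_smul, map_smul, hw, smul_zero]
  add_mem' {u w} hu hw := by
    simp only [Set.mem_ofPred_eq] at hu hw ⊢
    have h1 := hf _ (posSemidef_pureState (u + w))
    have h2 := hf _ (posSemidef_pureState (u - w))
    -- Parallelogram identity: two nonnegative values with sum zero both vanish.
    have h3 : pureState (u + w) + pureState (u - w) =
        (2 : ℝ) • pureState u + (2 : ℝ) • pureState w := by
      ext i j
      simp [pureState, vecMulVec_apply]
      ring
    have h4 := congrArg f h3
    rw [map_add, map_add, map_smul, map_smul, hu, hw, smul_zero, add_zero] at h4
    linarith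

theorem mem_nullSpace {m : Type*} [Fintype m] {f : Matrix m m ℂ →ₗ[ℝ] ℝ}
    {hf : ∀ X, X.PosSemidef → 0 ≤ f X} {w : m → ℂ} :
    w ∈ nullSpace f hf ↔ f (pureState w) = 0 :=
  Iff.rfl

/-- The functional has a positive lower bound on the compact unit sphere, and homogeneity of degree
two extends it to all vectors. -/
theorem exists_pos_forall_le {m : Type*} [Fintype m] {f : Matrix m m ℂ →ₗ[ℝ] ℝ}
    (hf : ∀ X, X.PosSemidef → 0 ≤ f X) (h0 : nullSpace f hf = ⊥) :
    ∃ ε : ℝ, 0 < ε ∧ ∀ v, ε * ∑ i, ‖v i‖ ^ 2 ≤ f (pureState v) := by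
  have hc : Continuous fun v : m → ℂ => f (pureState v) := by
    refine (LinearMap.continuous_of_finiteDimensional f).comp ?_
    unfold pureState
    fun_prop
  have hS : IsCompact {v : m → ℂ | ∑ i, ‖v i‖ ^ 2 = 1} := by
    refine Metric.isCompact_of_isClosed_isBounded
      (isClosed_eq (by fun_prop) continuous_const) ?_
    refine (Metric.isBounded_closedBall (x := (0 : m → ℂ)) (r := 1)).subset fun v hv => ?_
    rw [mem_closedBall_zero_iff, pi_norm_le_iff_of_nonneg zero_le_one]
    intro i
    have h : ‖v i‖ ^ 2 ≤ 1 := by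
      rw [← (show ∑ i, ‖v i‖ ^ 2 = 1 from hv)]
      exact Finset.single_le_sum (f := fun i => ‖v i‖ ^ 2) (fun _ _ => by positivity)
        (Finset.mem_univ i)
    exact (sq_le_one_iff₀ (norm_nonneg _)).1 h
  obtain ⟨ε, hε, h⟩ := hS.exists_forall_le' (a := 0) hc.continuousOn fun v hv => by
    refine lt_of_le_of_ne (hf _ (posSemidef_pureState v)) fun h => ?_
    have hv0 : v ∈ nullSpace f hf := h.symm
    rw [h0, Submodule.mem_bot] at hv0
    simp [hv0] at hv
  refine ⟨ε, hε, fun v => ?_⟩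
  set r := ∑ i, ‖v i‖ ^ 2 with hr
  have hr0 : 0 ≤ r := by positivity
  rcases hr0.eq_or_lt with h0 | hr0
  · rw [← h0, mul_zero]
    exact hf _ (posSemidef_pureState v)
  · have hs : ‖(((√r)⁻¹ : ℝ) : ℂ)‖ ^ 2 = r⁻¹ := by
      rw [Complex.norm_real, Real.norm_eq_abs, sq_abs, inv_pow, Real.sq_sqrt hr0.le]
    have := h ((((√r)⁻¹ : ℝ) : ℂ) • v) (by
      simp only [Set.mem_ofPred_eq, Pi.smul_apply, norm_smul, mul_pow, ← Finset.mul_sum, hs, ← hr]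
      exact inv_mul_cancel₀ hr0.ne')
    rw [pureState_smul, map_smul, hs, smul_eq_mul, inv_mul_eq_div, le_div_iff₀ hr0] at this
    exact this

/-! ### Propagators -/

section Propagator

variable {m : Type*} {E : ℕ → (Matrix m m ℂ →ₗ[ℂ] Matrix m m ℂ)}

theorem propagator_add (E : ℕ → (Matrix m m ℂ →ₗ[ℂ] Matrix m m ℂ)) (s k l : ℕ) :
    propagator E s (k + l) = propagator E (s + k) l ∘ₗ propagator E s k := by
  induction l with
  | zero => rfl
  | succ l ih =>
    rw [← add_assoc, propagator, propagator, ih, add_assoc, LinearMap.comp_assoc]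

theorem propagator_add_start {K : ℕ} (hE : ∀ t, E (t + K) = E t) (s a k : ℕ) :
    propagator E (s + K * a) k = propagator E s k := by
  have hE' : ∀ t, E (t + K * a) = E t := fun t => by
    induction a with
    | zero => rfl
    | succ a ih => rw [Nat.mul_succ, ← add_assoc, hE, ih]
  induction k with
  | zero => rfl
  | succ k ih => rw [propagator, propagator, ih, add_right_comm, hE']

theorem IsPositive.propagator (hE : ∀ t, IsPositive (E t)) (s k : ℕ) :
    IsPositive (propagator E s k) := by
  induction k with
  | zero => exact fun X hX => hX
  | succ k ih => exact fun X hX => hE _ _ (ih X hX)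

theorem trace_propagator [Fintype m] (hE : ∀ t X, (E t X).trace = X.trace) (s k : ℕ)
    (X : Matrix m m ℂ) : (propagator E s k X).trace = X.trace := by
  induction k with
  | zero => rfl
  | succ k ih => exact (hE _ _).trans ih

theorem propagator_eq_self {X : Matrix m m ℂ} (hE : ∀ t, E t X = X) (s k : ℕ) :
    propagator E s k X = X := by
  induction k with
  | zero => rfl
  | succ k ih => rw [propagator, LinearMap.comp_apply, ih, hE]

theorem le_fidelity_propagator [Fintype m] {ψ : m → ℂ} (hpos : ∀ t, IsPositive (E t))
    (hE : ∀ t X, X.PosSemidef → fidelity ψ X ≤ fidelity ψ (E t X)) (s k : ℕ)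
    {X : Matrix m m ℂ} (hX : X.PosSemidef) :
    fidelity ψ X ≤ fidelity ψ (propagator E s k X) := by
  induction k with
  | zero => exact le_rfl
  | succ k ih => exact ih.trans (hE _ _ (IsPositive.propagator hpos s k X hX))

theorem dominates_propagator [Fintype m] (hpos : ∀ t, IsPositive (E t))
    (hE : ∀ t X, X.PosSemidef → Dominates (E t X) X) (s k : ℕ)
    {X : Matrix m m ℂ} (hX : X.PosSemidef) :
    Dominates (propagator E s k X) X := by
  induction k with
  | zero => exact Dominates.refl X
  | succ k ih => exact (hE _ _ (IsPositive.propagator hpos s k X hX)).trans ih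

/-- The lazy parts of the other maps let the action of any single map survive, up to a constant. -/
theorem dominates_propagator_apply [Fintype m] (hpos : ∀ t, IsPositive (E t))
    (hE : ∀ t X, X.PosSemidef → Dominates (E t X) X) (s : ℕ) {j k : ℕ} (hjk : j < k)
    {X : Matrix m m ℂ} (hX : X.PosSemidef) :
    Dominates (propagator E s k X) (E (s + j) X) := by
  obtain ⟨l, rfl⟩ := Nat.exists_eq_add_of_le hjk
  rw [propagator_add]
  refine (dominates_propagator hpos hE _ _
    (IsPositive.propagator hpos s (j + 1) X hX)).trans ?_
  exact (dominates_propagator hpos hE s j hX).map (hpos _)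

end Propagator

/-! ### Convergence of periodic sequences -/

/-- A periodic sequence of positive maps whose Kraus operators leave no nonzero subspace avoiding
`ψ` invariant has a uniformly positive fidelity after finitely many periods. -/
theorem exists_fidelity_propagator_pos {m : Type*} [Fintype m] {ψ : m → ℂ}
    (hψ : ∑ x, ‖ψ x‖ ^ 2 = 1) {K : ℕ} {E : ℕ → (Matrix m m ℂ →ₗ[ℂ] Matrix m m ℂ)}
    {A : ℕ → Set (Matrix m m ℂ)} (hper : ∀ t, E (t + K) = E t)
    (hpos : ∀ t, IsPositive (E t))
    (hself : ∀ t X, X.PosSemidef → Dominates (E t X) X)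
    (hA : ∀ t, ∀ B ∈ A t, ∀ X : Matrix m m ℂ, X.PosSemidef → Dominates (E t X) (B * X * Bᴴ))
    (hirr : ∀ W : Submodule ℂ (m → ℂ),
      (∀ t < K, ∀ B ∈ A t, ∀ w ∈ W, B *ᵥ w ∈ W) → ψ ∉ W → W = ⊥) :
    ∃ k, ∃ ε : ℝ, 0 < ε ∧ ∀ v, ε * ∑ i, ‖v i‖ ^ 2 ≤
      fidelity ψ (propagator E 0 (K * k) (pureState v)) := by
  let f : ℕ → Matrix m m ℂ →ₗ[ℝ] ℝ := fun k =>
    fidelity ψ ∘ₗ (propagator E 0 (K * k)).restrictScalars ℝ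
  have hf : ∀ k X, X.PosSemidef → 0 ≤ f k X := fun k X hX =>
    fidelity_nonneg ψ (IsPositive.propagator hpos 0 _ X hX)
  have hsucc : ∀ k X, f (k + 1) X = f k (propagator E 0 K X) := by
    intro k X
    have h := propagator_add_start hper 0 1 (K * k)
    simp only [f, LinearMap.comp_apply, LinearMap.coe_restrictScalars]
    rw [Nat.mul_succ, add_comm, propagator_add, ← h, mul_one, LinearMap.comp_apply]
  have hmono : Antitone fun k => nullSpace (f k) (hf k) := by
    refine antitone_nat_of_succ_le fun k w hw => ?_
    rw [mem_nullSpace, hsucc] at hw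
    have hd := dominates_propagator hpos hself 0 K (posSemidef_pureState w)
    exact (hd.map (IsPositive.propagator hpos 0 (K * k))).fidelity_eq_zero
      (IsPositive.propagator hpos 0 (K * k) _ (posSemidef_pureState w)) hw
  have hbot : ⨅ k, nullSpace (f k) (hf k) = ⊥ := by
    refine hirr _ (fun t ht B hB w hw => ?_) fun h => ?_
    · rw [Submodule.mem_iInf] at hw ⊢
      intro k
      -- The extra period provides the application of `B`: zero fidelity for `w` after `k + 1`
      -- periods forces it for `B w` after `k`.
      have hw' := hw (k + 1)
      rw [mem_nullSpace, hsucc] at hw'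
      have hd := dominates_propagator_apply hpos hself 0 ht (posSemidef_pureState w)
      rw [zero_add] at hd
      have hd' := hd.trans (hA t B hB _ (posSemidef_pureState w))
      rw [mul_pureState_mul_conjTranspose] at hd'
      exact (hd'.map (IsPositive.propagator hpos 0 (K * k))).fidelity_eq_zero
        (IsPositive.propagator hpos 0 (K * k) _ (posSemidef_pureState _)) hw'
    · have h0 := (Submodule.mem_iInf _).1 h 0
      rw [mem_nullSpace] at h0
      change fidelity ψ (pureState ψ) = 0 at h0
      rw [fidelity_pureState] at h0
      have := trace_pureState ψ
      rw [hψ, pureState, trace_vecMulVec, dotProduct_comm] at this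
      simp [this] at h0
  -- A descending chain of subspaces stabilizes, so one `k` already realizes the zero intersection.
  obtain ⟨k, hk⟩ := IsArtinian.monotone_stabilizes (R := ℂ) (M := m → ℂ)
    ⟨fun k => OrderDual.toDual (nullSpace (f k) (hf k)), fun a b h => hmono h⟩
  refine ⟨k, exists_pos_forall_le (hf k) ?_⟩
  rw [eq_bot_iff, ← hbot]
  refine le_iInf fun l => ?_
  rcases le_total k l with h | h
  · exact (OrderDual.toDual.injective (hk l h)).le
  · exact hmono h

/-- Under the same conditions, trace-preserving maps drive all density matrices to `|ψ⟩⟨ψ|`. -/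
theorem tendsto_propagator {m : Type*} [Fintype m] {ψ : m → ℂ}
    (hψ : ∑ x, ‖ψ x‖ ^ 2 = 1) {K : ℕ} (hK : 0 < K)
    {E : ℕ → (Matrix m m ℂ →ₗ[ℂ] Matrix m m ℂ)}
    {A : ℕ → Set (Matrix m m ℂ)} (hper : ∀ t, E (t + K) = E t)
    (hpos : ∀ t, IsPositive (E t)) (htr : ∀ t X, (E t X).trace = X.trace)
    (hfid : ∀ t X, X.PosSemidef → fidelity ψ X ≤ fidelity ψ (E t X))
    (hself : ∀ t X, X.PosSemidef → Dominates (E t X) X)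
    (hA : ∀ t, ∀ B ∈ A t, ∀ X : Matrix m m ℂ, X.PosSemidef → Dominates (E t X) (B * X * Bᴴ))
    (hirr : ∀ W : Submodule ℂ (m → ℂ),
      (∀ t < K, ∀ B ∈ A t, ∀ w ∈ W, B *ᵥ w ∈ W) → ψ ∉ W → W = ⊥)
    {σ : Matrix m m ℂ} (hσ : IsDensity σ) (s : ℕ) :
    Tendsto (fun k => propagator E s k σ) atTop (𝓝 (pureState ψ)) := by
  have hdens : ∀ {X}, IsDensity X → ∀ s k, IsDensity (propagator E s k X) := fun hX s k =>
    ⟨IsPositive.propagator hpos s k _ hX.1, (trace_propagator htr s k _).trans hX.2⟩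
  have hψd : IsDensity (pureState ψ) :=
    ⟨posSemidef_pureState ψ, by rw [trace_pureState, hψ, Complex.ofReal_one]⟩
  have hψψ : fidelity ψ (pureState ψ) = 1 := by
    have := trace_pureState ψ
    rw [hψ, pureState, trace_vecMulVec, dotProduct_comm] at this
    simp [fidelity_pureState, this]
  obtain ⟨k, ε, hε, h⟩ := exists_fidelity_propagator_pos hψ hper hpos hself hA hirr
  have hstep : ∀ X, IsDensity X → fidelity ψ X + ε * (1 - fidelity ψ X) ≤
      fidelity ψ (propagator E 0 (K * k) X) := by
    intro X hX
    obtain ⟨r, v, rfl⟩ := exists_sum_pureState hX.1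
    have htr1 : ∑ i, ∑ x, ‖v i x‖ ^ 2 = 1 := by
      have := hX.2
      rw [trace_sum] at this
      simp only [trace_pureState] at this
      exact_mod_cast this
    have hv := fun i => le_of_fidelity_le hψ
      (f := fidelity ψ ∘ₗ (propagator E 0 (K * k)).restrictScalars ℝ)
      (fun u => le_fidelity_propagator hpos hfid 0 _ (posSemidef_pureState u))
      (le_antisymm (fidelity_le_one hψ (hdens hψd 0 _))
        (hψψ.ge.trans (le_fidelity_propagator hpos hfid 0 _ hψd.1))) h (v i)
    have hsum := Finset.sum_le_sum fun i (_ : i ∈ Finset.univ) => hv i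
    simp only [Finset.sum_add_distrib, ← Finset.mul_sum, Finset.sum_sub_distrib, htr1,
      ← fidelity_pureState, ← map_sum] at hsum
    exact hsum
  have hmono : Monotone fun k => fidelity ψ (propagator E s k σ) :=
    monotone_nat_of_le_succ fun k => hfid _ _ (hdens hσ s k).1
  have hbdd : BddAbove (Set.range fun k => fidelity ψ (propagator E s k σ)) :=
    ⟨1, by rintro _ ⟨k, rfl⟩; exact fidelity_le_one hψ (hdens hσ s k)⟩
  have hlim := tendsto_atTop_ciSup hmono hbdd
  set c := ⨆ k, fidelity ψ (propagator E s k σ)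
  have hc1 : c ≤ 1 := le_of_tendsto' hlim fun k => fidelity_le_one hψ (hdens hσ s k)
  -- Waiting `a` steps moves the starting time `s` to a multiple of the period.
  have hs : ∃ a, s + a = K * s := ⟨(K - 1) * s, by
    obtain ⟨K, rfl⟩ := Nat.exists_eq_succ_of_ne_zero hK.ne'
    simp only [Nat.succ_eq_add_one, Nat.add_sub_cancel]
    ring⟩
  obtain ⟨a, ha⟩ := hs
  have hineq : ∀ b, fidelity ψ (propagator E s (a + K * b) σ) +
      ε * (1 - fidelity ψ (propagator E s (a + K * b) σ)) ≤
      fidelity ψ (propagator E s (a + K * b + K * k) σ) := by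
    intro b
    have e : propagator E s (a + K * b + K * k) =
        propagator E 0 (K * k) ∘ₗ propagator E s (a + K * b) := by
      rw [propagator_add, ← add_assoc, ha, ← mul_add, ← zero_add (K * (s + b)),
        propagator_add_start hper]
    rw [e]
    exact hstep _ (hdens hσ s _)
  have hsub : Tendsto (fun b => a + K * b) atTop atTop :=
    tendsto_atTop_mono (fun b => (Nat.le_mul_of_pos_left b hK).trans (Nat.le_add_left _ _))
      tendsto_id
  have hl1 := hlim.comp hsub
  have hl2 := hlim.comp (tendsto_atTop_mono (fun b => Nat.le_add_right (a + K * b) (K * k)) hsub)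
  have hle := le_of_tendsto_of_tendsto'
    (hl1.add ((tendsto_const_nhds (x := (1 : ℝ)).sub hl1).const_mul ε)) hl2 hineq
  -- The limit satisfies `c + ε (1 - c) ≤ c` and `c ≤ 1`.
  have hc : c = 1 := by nlinarith
  rw [hc] at hlim
  exact tendsto_of_fidelity_tendsto hψ (hdens hσ s) hlim

/-! ### Lazy cooling maps and their Kraus operators -/

theorem posSemidef_real_smul {m : Type*} {X : Matrix m m ℂ} (hX : X.PosSemidef) {c : ℝ}
    (hc : 0 ≤ c) : (c • X).PosSemidef :=
  hX.smul hc

section Kraus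

variable {m : Type*} [Fintype m]

/-- Conjugation `X ↦ A X A†`. -/
def conjMap (A : Matrix m m ℂ) : Matrix m m ℂ →ₗ[ℂ] Matrix m m ℂ where
  toFun X := A * X * Aᴴ
  map_add' X Y := by rw [Matrix.mul_add, Matrix.add_mul]
  map_smul' c X := by simp

theorem conjMap_apply (A X : Matrix m m ℂ) : conjMap A X = A * X * Aᴴ := rfl

/-- The map `X ↦ (X + P X P† + c ∑ᵢ Aᵢ X Aᵢ†) / 2`. -/
def coolMap {ι : Type*} [Fintype ι] (P : Matrix m m ℂ) (A : ι → Matrix m m ℂ) (c : ℝ) :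
    Matrix m m ℂ →ₗ[ℂ] Matrix m m ℂ :=
  (1 / 2 : ℝ) • (LinearMap.id + conjMap P + c • ∑ i, conjMap (A i))

theorem coolMap_apply {ι : Type*} [Fintype ι] (P : Matrix m m ℂ) (A : ι → Matrix m m ℂ) (c : ℝ)
    (X : Matrix m m ℂ) :
    coolMap P A c X = (1 / 2 : ℝ) • (X + P * X * Pᴴ + c • ∑ i, A i * X * (A i)ᴴ) := by
  simp [coolMap, conjMap_apply]

theorem dominates_coolMap {ι : Type*} [Fintype ι] (P : Matrix m m ℂ) (A : ι → Matrix m m ℂ)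
    {c : ℝ} (hc : 0 ≤ c) {X : Matrix m m ℂ} (hX : X.PosSemidef) :
    Dominates (coolMap P A c X) X := by
  refine ⟨1 / 2, by norm_num, ?_⟩
  rw [coolMap_apply, ← smul_sub, add_assoc, add_sub_cancel_left]
  exact posSemidef_real_smul ((hX.mul_mul_conjTranspose_same P).add
    (posSemidef_real_smul (posSemidef_sum _ fun i _ => hX.mul_mul_conjTranspose_same (A i)) hc))
    (by norm_num)

theorem dominates_coolMap_kraus {ι : Type*} [Fintype ι] (P : Matrix m m ℂ)
    (A : ι → Matrix m m ℂ) {c : ℝ} (hc : 0 < c) {X : Matrix m m ℂ} (hX : X.PosSemidef) (i : ι) :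
    Dominates (coolMap P A c X) (A i * X * (A i)ᴴ) := by
  classical
  refine ⟨1 / 2 * c, by positivity, ?_⟩
  rw [coolMap_apply, mul_smul, ← smul_sub, add_sub_assoc, ← smul_sub,
    ← Finset.sum_erase_eq_sub (Finset.mem_univ i)]
  exact posSemidef_real_smul ((hX.add (hX.mul_mul_conjTranspose_same P)).add
    (posSemidef_real_smul (posSemidef_sum _ fun i _ => hX.mul_mul_conjTranspose_same (A i)) hc.le))
    (by norm_num)

theorem isPositive_coolMap {ι : Type*} [Fintype ι] (P : Matrix m m ℂ) (A : ι → Matrix m m ℂ)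
    {c : ℝ} (hc : 0 ≤ c) : IsPositive (coolMap P A c) := by
  intro X hX
  rw [coolMap_apply]
  exact posSemidef_real_smul ((hX.add (hX.mul_mul_conjTranspose_same P)).add
    (posSemidef_real_smul (posSemidef_sum _ fun i _ => hX.mul_mul_conjTranspose_same (A i)) hc))
    (by norm_num)

/-- Both `X` and `P X P†` have the fidelity of `X`, which compensates the factor 1/2; the other
terms only add. -/
theorem le_fidelity_coolMap {ι : Type*} [Fintype ι] {P : Matrix m m ℂ} (A : ι → Matrix m m ℂ)
    {c : ℝ} (hc : 0 ≤ c) {ψ : m → ℂ} (hP : Pᴴ *ᵥ ψ = ψ) {X : Matrix m m ℂ} (hX : X.PosSemidef) :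
    fidelity ψ X ≤ fidelity ψ (coolMap P A c X) := by
  have h1 : fidelity ψ (P * X * Pᴴ) = fidelity ψ X := by
    have : star ψ ᵥ* P = star ψ := by
      rw [← star_star (star ψ ᵥ* P), star_vecMul, star_star, hP]
    simp only [fidelity, LinearMap.coe_mk, AddHom.coe_mk]
    rw [← mulVec_mulVec, hP, ← mulVec_mulVec, dotProduct_mulVec, this]
  have h2 : 0 ≤ fidelity ψ (∑ i, A i * X * (A i)ᴴ) :=
    fidelity_nonneg ψ (posSemidef_sum _ fun i _ => hX.mul_mul_conjTranspose_same (A i))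
  rw [coolMap_apply, map_smul, map_add, map_add, map_smul, h1, smul_eq_mul, smul_eq_mul]
  have := mul_nonneg hc h2
  linarith

theorem coolMap_pureState {ι : Type*} [Fintype ι] {P : Matrix m m ℂ} {A : ι → Matrix m m ℂ}
    (c : ℝ) {ψ : m → ℂ} (hP : P *ᵥ ψ = ψ) (hA : ∀ i, A i *ᵥ ψ = 0) :
    coolMap P A c (pureState ψ) = pureState ψ := by
  have h0 : pureState (0 : m → ℂ) = 0 := by simp [pureState]
  simp only [coolMap_apply, mul_pureState_mul_conjTranspose, hP, hA, h0, Finset.sum_const_zero,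
    smul_zero, add_zero, ← two_smul ℝ (pureState ψ), smul_smul]
  norm_num

theorem trace_coolMap [DecidableEq m] {ι : Type*} [Fintype ι] {P : Matrix m m ℂ}
    {A : ι → Matrix m m ℂ} {c : ℝ} (h : Pᴴ * P + c • ∑ i, (A i)ᴴ * A i = 1) (X : Matrix m m ℂ) :
    (coolMap P A c X).trace = X.trace := by
  have h1 : (P * X * Pᴴ + c • ∑ i, A i * X * (A i)ᴴ).trace = X.trace := by
    rw [trace_add, trace_smul, trace_sum]
    simp only [fun B : Matrix m m ℂ => trace_mul_cycle B X Bᴴ]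
    rw [← trace_sum, ← trace_smul, ← trace_add, ← Finset.sum_mul, ← Matrix.smul_mul,
      ← Matrix.add_mul, h, Matrix.one_mul]
  rw [coolMap_apply, add_assoc, trace_smul, trace_add, h1, ← two_smul ℝ X.trace, smul_smul]
  norm_num

/-- Ampliation tensors each Kraus operator with the identity, so complete positivity reduces to
positivity of a map of the same form. -/
theorem ampliate_coolMap (e : Type*) [Fintype e] [DecidableEq e] {ι : Type*} [Fintype ι]
    (P : Matrix m m ℂ) (A : ι → Matrix m m ℂ) (c : ℝ) (X : Matrix (m × e) (m × e) ℂ) :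
    ampliate e (coolMap P A c) X =
      coolMap (P ⊗ₖ (1 : Matrix e e ℂ)) (fun i => A i ⊗ₖ (1 : Matrix e e ℂ)) c X := by
  have key : ∀ (B : Matrix m m ℂ) (p q : m × e),
      ((B ⊗ₖ (1 : Matrix e e ℂ)) * X * (B ⊗ₖ (1 : Matrix e e ℂ))ᴴ) p q =
        (B * (Matrix.of fun i j => X (i, p.2) (j, q.2)) * Bᴴ) p.1 q.1 := by
    intro B p q
    simp only [Matrix.mul_apply, conjTranspose_apply, kroneckerMap_apply, Fintype.sum_prod_type,
      Matrix.one_apply, Matrix.of_apply, mul_ite, ite_mul, mul_one, mul_zero, zero_mul, star_zero,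
      apply_ite (star : ℂ → ℂ), Finset.sum_ite_eq, Finset.mem_univ, if_true]
  ext p q
  simp only [ampliate, LinearMap.coe_mk, AddHom.coe_mk, Matrix.of_apply, coolMap_apply,
    Matrix.add_apply, Matrix.smul_apply, Matrix.sum_apply, key]

theorem isCPTP_coolMap {ι : Type*} [Fintype ι] {P : Matrix m m ℂ} {A : ι → Matrix m m ℂ} {c : ℝ}
    (hc : 0 ≤ c) (h : ∀ X : Matrix m m ℂ, (coolMap P A c X).trace = X.trace) :
    IsCPTP (coolMap P A c) where
  completely_positive k X hX := by
    rw [ampliate_coolMap]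
    exact isPositive_coolMap _ _ hc X hX
  trace_preserving := h

theorem exists_orthogonal_projection [DecidableEq m] (V : Submodule ℂ (m → ℂ)) :
    ∃ P : Matrix m m ℂ, Pᴴ = P ∧ P * P = P ∧ ∀ u, P *ᵥ u = u ↔ u ∈ V := by
  let U : Submodule ℂ (EuclideanSpace ℂ m) :=
    V.comap (WithLp.linearEquiv 2 ℂ (m → ℂ)).toLinearMap
  let e := Matrix.toEuclideanCLM (𝕜 := ℂ) (n := m)
  have hU : IsStarProjection U.starProjection := isStarProjection_starProjection
  refine ⟨e.symm U.starProjection, ?_, ?_, fun u => ?_⟩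
  · exact (e.symm.map_star' _).symm.trans (congrArg e.symm hU.isSelfAdjoint.star_eq)
  · rw [← map_mul, hU.isIdempotentElem.eq]
  · have h := Submodule.starProjection_eq_self_iff (K := U) (v := WithLp.toLp 2 u)
    have h2 : U.starProjection (WithLp.toLp 2 u) =
        WithLp.toLp 2 (e.symm U.starProjection *ᵥ u) := by
      conv_lhs => rw [← e.apply_symm_apply U.starProjection]
      rfl
    rw [h2] at h
    rw [← (WithLp.toLp_injective 2).eq_iff, h]
    rfl

/-- The Kraus operators `|a⟩⟨b|Q` of the map `X ↦ Tr(Q X) 1` for a projection `Q`. -/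
theorem sum_single_mul [DecidableEq m] {P : Matrix m m ℂ} (hP : Pᴴ = P) (hPP : P * P = P) :
    ∑ ab : m × m, (single ab.1 ab.2 (1 : ℂ) * (1 - P))ᴴ * (single ab.1 ab.2 1 * (1 - P)) =
      (Fintype.card m : ℂ) • (1 - P) := by
  have h : ∀ ab : m × m, (single ab.1 ab.2 (1 : ℂ) * (1 - P))ᴴ * (single ab.1 ab.2 1 * (1 - P)) =
      (1 - P) * (single ab.2 ab.2 1 * (1 - P)) := by
    intro ab
    rw [conjTranspose_mul, conjTranspose_sub, conjTranspose_one, hP, Matrix.mul_assoc,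
      ← Matrix.mul_assoc (single ab.1 ab.2 (1 : ℂ))ᴴ, conjTranspose_single, star_one,
      single_mul_single_same, mul_one]
  have h1 : ∑ b : m, single b b (1 : ℂ) = 1 := by
    ext i j
    simp only [Matrix.sum_apply, single_apply, Matrix.one_apply, ite_and, Finset.sum_ite_eq',
      Finset.mem_univ, if_true]
  have hQ : (1 - P) * (1 - P) = 1 - P := by
    simp [Matrix.mul_sub, Matrix.sub_mul, hPP]
  simp only [h]
  rw [← Finset.mul_sum, ← Finset.sum_mul, Fintype.sum_prod_type]
  simp only [h1, Finset.sum_const, Finset.card_univ, ← Nat.cast_smul_eq_nsmul ℂ,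
    Matrix.smul_mul, Matrix.mul_smul, Matrix.one_mul, hQ]

end Kraus

/-! ### Local operators and reduced supports -/

section Local

variable {n : ℕ} {d : Fin n → ℕ}

theorem split_symm_apply_mem {S : Finset (Fin n)} (i : InConfig d S) (o : OutConfig d S)
    {a : Fin n} (ha : a ∈ S) : (split d S).symm (i, o) a = i ⟨a, ha⟩ := by
  simp [split, Equiv.piEquivPiSubtypeProd, ha]

theorem split_symm_apply_notMem {S : Finset (Fin n)} (i : InConfig d S) (o : OutConfig d S)
    {a : Fin n} (ha : a ∉ S) : (split d S).symm (i, o) a = o ⟨a, ha⟩ := by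
  simp [split, Equiv.piEquivPiSubtypeProd, ha]

theorem split_fst_apply {S : Finset (Fin n)} (c : Config d) (a : {a : Fin n // a ∈ S}) :
    (split d S c).1 a = c a := rfl

theorem split_snd_apply {S : Finset (Fin n)} (c : Config d) (a : {a : Fin n // a ∉ S}) :
    (split d S c).2 a = c a := rfl

/-- The component of a vector of `H` in `H_S ⊗ |o⟩`. -/
def block (S : Finset (Fin n)) (w : Config d → ℂ) (o : OutConfig d S) : InConfig d S → ℂ :=
  fun i => w ((split d S).symm (i, o))

/-- The operator `A ⊗ 1` on `H`. -/
def localOp (S : Finset (Fin n)) (A : Matrix (InConfig d S) (InConfig d S) ℂ) :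
    Matrix (Config d) (Config d) ℂ :=
  (A ⊗ₖ (1 : Matrix (OutConfig d S) (OutConfig d S) ℂ)).submatrix (split d S) (split d S)

theorem localOp_conjTranspose (S : Finset (Fin n))
    (A : Matrix (InConfig d S) (InConfig d S) ℂ) : (localOp S A)ᴴ = localOp S Aᴴ := by
  rw [localOp, conjTranspose_submatrix, conjTranspose_kronecker, conjTranspose_one, localOp]

theorem localOp_mulVec (S : Finset (Fin n)) (A : Matrix (InConfig d S) (InConfig d S) ℂ)
    (w : Config d → ℂ) (c : Config d) :
    (localOp S A *ᵥ w) c = (A *ᵥ block S w (split d S c).2) (split d S c).1 := by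
  simp only [mulVec, dotProduct, localOp, submatrix_apply]
  rw [← (split d S).symm.sum_comp, Fintype.sum_prod_type]
  simp [Matrix.one_apply, kroneckerMap_apply, block]

theorem extendMap_coolMap (S : Finset (Fin n)) {ι : Type*} [Fintype ι]
    (P : Matrix (InConfig d S) (InConfig d S) ℂ)
    (A : ι → Matrix (InConfig d S) (InConfig d S) ℂ) (c : ℝ) (X : Matrix (Config d) (Config d) ℂ) :
    extendMap S (coolMap P A c) X = coolMap (localOp S P) (fun i => localOp S (A i)) c X := by
  have key : ∀ B : Matrix (InConfig d S × OutConfig d S) (InConfig d S × OutConfig d S) ℂ,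
      (B * X.submatrix (split d S).symm (split d S).symm * Bᴴ).submatrix
        (split d S) (split d S) =
      B.submatrix (split d S) (split d S) * X * (B.submatrix (split d S) (split d S))ᴴ := by
    intro B
    have hX : X = (X.submatrix (split d S).symm (split d S).symm).submatrix
        (split d S) (split d S) := by simp
    conv_rhs => rw [hX]
    rw [conjTranspose_submatrix, submatrix_mul_equiv, submatrix_mul_equiv]
  rw [extendMap, ampliate_coolMap, coolMap_apply, coolMap_apply]
  ext p q
  have hs := fun B => congrFun (congrFun (key B) p) q
  simp only [submatrix_apply] at hs
  simp only [submatrix_apply, Matrix.add_apply, Matrix.smul_apply, Matrix.sum_apply, hs,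
    Equiv.symm_apply_apply]
  rfl

theorem trace_extendMap (S : Finset (Fin n))
    {Φ : Matrix (InConfig d S) (InConfig d S) ℂ →ₗ[ℂ] Matrix (InConfig d S) (InConfig d S) ℂ}
    (hΦ : ∀ X, (Φ X).trace = X.trace) (X : Matrix (Config d) (Config d) ℂ) :
    (extendMap S Φ X).trace = X.trace := by
  have h1 : ∀ Y : Matrix (Config d) (Config d) ℂ, Y.trace = ∑ o : OutConfig d S,
      ∑ i : InConfig d S, Y ((split d S).symm (i, o)) ((split d S).symm (i, o)) := by
    intro Y
    rw [trace, ← (split d S).symm.sum_comp, Fintype.sum_prod_type, Finset.sum_comm]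
    rfl
  rw [h1, h1]
  refine Finset.sum_congr rfl fun o _ => ?_
  simp only [extendMap, ampliate, submatrix_apply, Equiv.apply_symm_apply, LinearMap.coe_mk,
    AddHom.coe_mk, Matrix.of_apply]
  exact hΦ _

theorem mem_extendSubspace {S : Finset (Fin n)} {V : Submodule ℂ (InConfig d S → ℂ)}
    {w : Config d → ℂ} : w ∈ extendSubspace S V ↔ ∀ o, block S w o ∈ V := by
  constructor
  · intro hw o
    induction hw using Submodule.span_induction with
    | mem x hx =>
      obtain ⟨u, hu, v, rfl⟩ := hx
      have : block S (fun x => u (split d S x).1 * v (split d S x).2) o = v o • u := by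
        ext i
        simp [block, mul_comm]
      rw [this]
      exact V.smul_mem _ hu
    | zero => exact V.zero_mem
    | add x y _ _ hx hy => exact V.add_mem hx hy
    | smul c x _ hx => exact V.smul_mem c hx
  · intro h
    have hw : w = ∑ o, fun x => block S w o (split d S x).1 *
        (Pi.single o (1 : ℂ) : OutConfig d S → ℂ) (split d S x).2 := by
      ext x
      simp [Finset.sum_apply, Pi.single_apply, block]
    rw [hw]
    exact Submodule.sum_mem _ fun o _ => Submodule.subset_span ⟨_, h o, _, rfl⟩

/-- With the blocks of `ψ` as columns of a matrix `M`, the reduced state is `M M†`, which has the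
same range as `M`. -/
theorem supp_reducedState (S : Finset (Fin n)) (ψ : Config d → ℂ) :
    supp (reducedState S (pureState ψ)) = Submodule.span ℂ (Set.range (block S ψ)) := by
  let M : Matrix (InConfig d S) (OutConfig d S) ℂ := Matrix.of fun i o => block S ψ o i
  have hM : reducedState S (pureState ψ) = M * Mᴴ := by
    ext i j
    simp [reducedState, pureState, vecMulVec_apply, Matrix.mul_apply, M, block]
  have hr : LinearMap.range M.mulVecLin = Submodule.span ℂ (Set.range (block S ψ)) :=
    range_mulVecLin M
  rw [supp, hM, ← hr]
  refine Submodule.eq_of_le_of_finrank_eq ?_ (rank_self_mul_conjTranspose M)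
  rw [mulVecLin_mul]
  exact LinearMap.range_comp_le_range _ _

theorem mem_supp_pureState {m : Type*} [Fintype m] {ψ w : m → ℂ} (h : w ∈ supp (pureState ψ)) :
    ∃ c : ℂ, w = c • ψ := by
  obtain ⟨u, rfl⟩ := h
  refine ⟨star ψ ⬝ᵥ u, ?_⟩
  rw [mulVecLin_apply, pureState, vecMulVec_mulVec]
  ext i
  simp [mul_comm]

end Local

/-! ### Irreducibility -/

section Irreducibility

variable {n : ℕ} {d : Fin n → ℕ}

/-- `W` contains `H_S ⊗ x` for some nonzero vector `x` of the complementary factor. -/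
def ContainsFactor (W : Submodule ℂ (Config d → ℂ)) (S : Finset (Fin n)) : Prop :=
  ∃ x : Config d → ℂ, x ≠ 0 ∧ DependsOn x (↑S : Set (Fin n))ᶜ ∧
    ∀ h : Config d → ℂ, DependsOn h (↑S : Set (Fin n)) → h * x ∈ W

theorem containsFactor_empty {W : Submodule ℂ (Config d → ℂ)} (hW : W ≠ ⊥) :
    ContainsFactor W ∅ := by
  obtain ⟨x, hx, hx0⟩ := W.exists_mem_ne_zero_of_ne_bot hW
  obtain ⟨c, -⟩ := Function.ne_iff.1 hx0
  refine ⟨x, hx0, fun a b h => congrArg x (funext fun i => h i (by simp)), fun h hh => ?_⟩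
  have : h * x = h c • x := by
    ext b
    simp [hh (x := b) (y := c) (by simp)]
  rw [this]
  exact W.smul_mem _ hx

/-- The operators `|i⟩⟨b|Q` overwrite the factor on `N` by any basis vector, leaving behind the
vector `⟨b|Q(h ⊗ x)`. Once `h` is frozen outside `N`, this leftover depends only on coordinates
outside `S ∪ N` and serves as the new `x`. -/
theorem ContainsFactor.union {W : Submodule ℂ (Config d → ℂ)} {S N : Finset (Fin n)}
    {Q : Matrix (InConfig d N) (InConfig d N) ℂ}
    (hW : ∀ a b, ∀ w ∈ W, localOp N (single a b 1 * Q) *ᵥ w ∈ W)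
    {x h : Config d → ℂ} (hx : DependsOn x (↑S : Set (Fin n))ᶜ)
    (hxW : ∀ h : Config d → ℂ, DependsOn h (↑S : Set (Fin n)) → h * x ∈ W)
    (hh : DependsOn h (↑S : Set (Fin n))) {o : OutConfig d N} {b : InConfig d N}
    (hne : (Q *ᵥ block N (h * x) o) b ≠ 0) : ContainsFactor W (S ∪ N) := by
  classical
  let h₁ : Config d → ℂ := fun c => h ((split d N).symm ((split d N c).1, o))
  have hh₁ : DependsOn h₁ (↑S : Set (Fin n)) := by
    intro c c' hc
    refine hh fun a ha => ?_
    by_cases haN : a ∈ N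
    · rw [split_symm_apply_mem _ _ haN, split_symm_apply_mem _ _ haN]
      exact hc a ha
    · rw [split_symm_apply_notMem _ _ haN, split_symm_apply_notMem _ _ haN]
  refine ⟨fun c => (Q *ᵥ block N (h₁ * x) (split d N c).2) b, ?_, ?_, ?_⟩
  · rw [Function.ne_iff]
    refine ⟨(split d N).symm (b, o), ?_⟩
    have : block N (h₁ * x) o = block N (h * x) o := by
      ext i
      simp [block, h₁]
    simpa [this] using hne
  · intro c c' hc
    have : block N (h₁ * x) (split d N c).2 = block N (h₁ * x) (split d N c').2 := by
      ext i
      simp only [block, Pi.mul_apply, h₁, Equiv.apply_symm_apply]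
      congr 1
      refine hx fun a ha => ?_
      by_cases haN : a ∈ N
      · rw [split_symm_apply_mem _ _ haN, split_symm_apply_mem _ _ haN]
      · rw [split_symm_apply_notMem _ _ haN, split_symm_apply_notMem _ _ haN]
        refine hc a ?_
        simp only [Set.mem_compl_iff, Finset.mem_coe, Finset.mem_union] at ha ⊢
        tauto
    simp only [this]
  · intro g hg
    -- For each value `i` on `N`, the rest of `g` is a function on `S`, so it can be absorbed before
    -- `|i⟩⟨b|Q` acts.
    let h₂ : InConfig d N → Config d → ℂ := fun i c => g ((split d N).symm (i, (split d N c).2))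
    have hh₂ : ∀ i, DependsOn (h₂ i * h₁) (↑S : Set (Fin n)) := by
      intro i c c' hc
      simp only [Pi.mul_apply, hh₁ hc]
      congr 1
      refine hg fun a ha => ?_
      by_cases haN : a ∈ N
      · rw [split_symm_apply_mem _ _ haN, split_symm_apply_mem _ _ haN]
      · rw [split_symm_apply_notMem _ _ haN, split_symm_apply_notMem _ _ haN]
        refine hc a ?_
        simpa [haN] using ha
    have hsum : g * (fun c => (Q *ᵥ block N (h₁ * x) (split d N c).2) b) =
        ∑ i, localOp N (single i b 1 * Q) *ᵥ (h₂ i * h₁ * x) := by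
      ext c
      have hb : ∀ i, block N (h₂ i * h₁ * x) (split d N c).2 =
          g ((split d N).symm (i, (split d N c).2)) • block N (h₁ * x) (split d N c).2 := by
        intro i
        ext j
        simp [block, h₂, mul_assoc]
      simp only [Finset.sum_apply, localOp_mulVec, ← mulVec_mulVec, hb, mulVec_smul,
        single_mulVec, Pi.smul_apply, Function.update_apply, Pi.zero_apply, one_mul, Pi.mul_apply,
        smul_eq_mul, mul_ite, mul_zero, Finset.sum_ite_eq, Finset.mem_univ, if_true,
        Prod.mk.eta, Equiv.symm_apply_apply]
    rw [hsum]
    exact W.sum_mem fun i _ => hW i b _ (hxW _ (hh₂ i))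

/-- If `ψ` is determined by the supports of its reduced states, then the operators `|a⟩⟨b|Q_j`, for
`Q_j` with kernel the support of the reduced state, leave no nonzero subspace avoiding `ψ`
invariant. -/
theorem eq_bot_of_invariant {K : ℕ} {N : Fin K → Finset (Fin n)} {ψ : Config d → ℂ} (hψ : ψ ≠ 0)
    (hsupp : ⨅ j, extendSubspace (N j) (supp (reducedState (N j) (pureState ψ))) ≤
      supp (pureState ψ))
    {Q : ∀ j, Matrix (InConfig d (N j)) (InConfig d (N j)) ℂ}
    (hQ : ∀ j u, Q j *ᵥ u = 0 → u ∈ supp (reducedState (N j) (pureState ψ)))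
    {W : Submodule ℂ (Config d → ℂ)}
    (hW : ∀ j a b, ∀ w ∈ W, localOp (N j) (single a b 1 * Q j) *ᵥ w ∈ W) (hψW : ψ ∉ W) :
    W = ⊥ := by
  by_contra hne
  obtain ⟨S, hS⟩ := (Set.toFinite {S | ContainsFactor W S}).exists_maximal
    ⟨∅, containsFactor_empty hne⟩
  obtain ⟨x, hx0, hx, hxW⟩ := hS.prop
  have hmax : ∀ j, ¬ N j ⊆ S → ∀ h : Config d → ℂ, DependsOn h (↑S : Set (Fin n)) →
      h * x ∈ extendSubspace (N j) (supp (reducedState (N j) (pureState ψ))) := by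
    intro j hj h hh
    refine mem_extendSubspace.2 fun o => hQ j _ (funext fun b => ?_)
    by_contra hb
    have hu := ContainsFactor.union (hW j) hx hxW hh hb
    exact hj (Finset.subset_union_right.trans (hS.le_of_ge hu Finset.subset_union_left))
  obtain ⟨y, hy⟩ := Function.ne_iff.1 hψ
  obtain ⟨z, hz⟩ := Function.ne_iff.1 hx0
  -- The slice of `ψ` on `S`, with the coordinates outside `S` frozen at a point where `ψ ≠ 0`.
  let φ : Config d → ℂ := fun c => ψ ((split d S).symm ((split d S c).1, (split d S y).2))
  have hφ : DependsOn φ (↑S : Set (Fin n)) := by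
    intro c c' hc
    have : (split d S c).1 = (split d S c').1 := funext fun a => hc a a.2
    simp only [φ, this]
  have hmem : φ * x ∈ supp (pureState ψ) := by
    refine hsupp ((Submodule.mem_iInf _).2 fun j => ?_)
    by_cases hj : N j ⊆ S
    · refine mem_extendSubspace.2 fun o => ?_
      let c : InConfig d (N j) → Config d := fun i => (split d (N j)).symm (i, o)
      let c' : InConfig d (N j) → Config d := fun i =>
        (split d S).symm ((split d S (c i)).1, (split d S y).2)
      let i₀ := (split d (N j) y).1
      -- Only the coordinates in `N j` vary with `i`, so the blocks of `φ * x` are multiples of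
      -- blocks of `ψ`; `i₀` is just a reference value.
      have hc' : ∀ i, c' i = (split d (N j)).symm (i, (split d (N j) (c' i₀)).2) := by
        intro i
        ext1 a
        by_cases haN : a ∈ N j
        · simp only [c']
          rw [split_symm_apply_mem _ _ (hj haN), split_symm_apply_mem _ _ haN, split_fst_apply]
          simp only [c]
          rw [split_symm_apply_mem _ _ haN]
        · rw [split_symm_apply_notMem _ _ haN, split_snd_apply]
          simp only [c']
          by_cases haS : a ∈ S
          · rw [split_symm_apply_mem _ _ haS, split_symm_apply_mem _ _ haS, split_fst_apply,
              split_fst_apply]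
            simp only [c]
            rw [split_symm_apply_notMem _ _ haN, split_symm_apply_notMem _ _ haN]
          · rw [split_symm_apply_notMem _ _ haS, split_symm_apply_notMem _ _ haS]
      have hb : block (N j) (φ * x) o =
          x (c i₀) • block (N j) ψ (split d (N j) (c' i₀)).2 := by
        ext i
        have hxi : x (c i) = x (c i₀) := hx fun a ha => by
          have haN : a ∉ N j := fun h => ha (hj h)
          simp only [c]
          rw [split_symm_apply_notMem _ _ haN, split_symm_apply_notMem _ _ haN]
        have hφi : φ (c i) = ψ (c' i) := rfl
        change φ (c i) * x (c i) = _
        rw [hφi, hxi, hc' i, mul_comm]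
        rfl
      rw [hb, supp_reducedState]
      exact Submodule.smul_mem _ _ (Submodule.subset_span ⟨_, rfl⟩)
    · exact hmax j hj φ hφ
  obtain ⟨r, hr⟩ := mem_supp_pureState hmem
  have hr0 : r ≠ 0 := by
    rintro rfl
    -- Gluing `y` on `S` to `z` off `S` gives a point where `φ * x` equals `ψ y * x z ≠ 0`.
    have h := congrFun hr ((split d S).symm ((split d S y).1, (split d S z).2))
    have hxz : x ((split d S).symm ((split d S y).1, (split d S z).2)) = x z :=
      hx fun a ha => by rw [split_symm_apply_notMem _ _ ha]; rfl
    simp only [Pi.mul_apply, φ, Equiv.apply_symm_apply, Prod.mk.eta, Equiv.symm_apply_apply,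
      zero_smul, Pi.zero_apply, hxz, mul_eq_zero] at h
    exact h.elim hy hz
  refine hψW ?_
  have := W.smul_mem r⁻¹ (hxW φ hφ)
  rwa [hr, inv_smul_smul₀ hr0] at this

end Irreducibility

/-! ### The two implications -/

section Stabilization

variable {n : ℕ} {d : Fin n → ℕ}

theorem supp_pureState_le_extendSubspace (S : Finset (Fin n)) (ψ : Config d → ℂ) :
    supp (pureState ψ) ≤ extendSubspace S (supp (reducedState S (pureState ψ))) := by
  intro w hw
  obtain ⟨c, rfl⟩ := mem_supp_pureState hw
  refine Submodule.smul_mem _ c (mem_extendSubspace.2 fun o => ?_)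
  rw [supp_reducedState]
  exact Submodule.subset_span ⟨o, rfl⟩

theorem extendMap_pureState_apply (S : Finset (Fin n))
    (Φ : Matrix (InConfig d S) (InConfig d S) ℂ →ₗ[ℂ] Matrix (InConfig d S) (InConfig d S) ℂ)
    (w : Config d → ℂ) (p q : Config d) :
    extendMap S Φ (pureState w) p q =
      Φ (vecMulVec (block S w (split d S p).2) (star (block S w (split d S q).2)))
        (split d S p).1 (split d S q).1 :=
  rfl

/-- A map `Φ ⊗ id` that fixes `|ψ⟩⟨ψ|` fixes all pure states in `supp(ρ_S) ⊗ H_{Sᶜ}`. -/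
theorem extendMap_pureState_eq_self {S : Finset (Fin n)}
    {Φ : Matrix (InConfig d S) (InConfig d S) ℂ →ₗ[ℂ] Matrix (InConfig d S) (InConfig d S) ℂ}
    {ψ φ : Config d → ℂ} (hψ : extendMap S Φ (pureState ψ) = pureState ψ)
    (hφ : φ ∈ extendSubspace S (supp (reducedState S (pureState ψ)))) :
    extendMap S Φ (pureState φ) = pureState φ := by
  have hblock : ∀ o o', Φ (vecMulVec (block S ψ o) (star (block S ψ o'))) =
      vecMulVec (block S ψ o) (star (block S ψ o')) := by
    intro o o'
    ext i j
    have h := congrFun (congrFun hψ ((split d S).symm (i, o))) ((split d S).symm (j, o'))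
    rw [extendMap_pureState_apply] at h
    simp only [Equiv.apply_symm_apply] at h
    exact h
  have hspan : ∀ u ∈ Submodule.span ℂ (Set.range (block S ψ)),
      ∀ v ∈ Submodule.span ℂ (Set.range (block S ψ)),
        Φ (vecMulVec u (star v)) = vecMulVec u (star v) := by
    intro u hu v hv
    induction hu using Submodule.span_induction with
    | mem u hu =>
      obtain ⟨o, rfl⟩ := hu
      induction hv using Submodule.span_induction with
      | mem v hv =>
        obtain ⟨o', rfl⟩ := hv
        exact hblock o o'
      | zero => simp
      | add v w _ _ hv hw => rw [star_add, vecMulVec_add, map_add, hv, hw]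
      | smul c v _ hv =>
        have : vecMulVec (block S ψ o) (star (c • v)) =
            star c • vecMulVec (block S ψ o) (star v) := by
          rw [star_smul, vecMulVec_smul]
        rw [this, map_smul, hv]
    | zero => simp
    | add u w _ _ hu hw => rw [add_vecMulVec, map_add, hu, hw]
    | smul c u _ hu => rw [smul_vecMulVec, map_smul, hu]
  have hφ' := mem_extendSubspace.1 hφ
  rw [supp_reducedState] at hφ'
  ext p q
  rw [extendMap_pureState_apply, hspan _ (hφ' _) _ (hφ' _)]
  simp [vecMulVec_apply, pureState, block]

theorem IsQLS.iInf_le {K : ℕ} {N : Fin K → Finset (Fin n)} {ψ : Config d → ℂ}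
    (h : IsQLS N (pureState ψ)) :
    ⨅ j, extendSubspace (N j) (supp (reducedState (N j) (pureState ψ))) ≤
      supp (pureState ψ) := by
  intro φ hφ
  obtain ⟨E, hE, hfix, hlim⟩ := h
  have hEψ : ∀ t, E t (pureState ψ) = pureState ψ := fun t => hfix t 1
  have hEφ : ∀ r : ℂ, ∀ t, E t (pureState (r • φ)) = pureState (r • φ) := by
    intro r t
    obtain ⟨-, j, Φ, hΦ⟩ := hE t
    have h1 := hEψ t
    rw [hΦ] at h1 ⊢
    exact extendMap_pureState_eq_self h1
      (Submodule.smul_mem _ r ((Submodule.mem_iInf _).1 hφ j))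
  by_cases h0 : φ = 0
  · rw [h0]
    exact Submodule.zero_mem _
  obtain ⟨i, hi⟩ := Function.ne_iff.1 h0
  set r := ∑ i, ‖φ i‖ ^ 2 with hr
  have hr0 : 0 < r := Finset.sum_pos' (fun _ _ => by positivity)
    ⟨i, Finset.mem_univ i, pow_pos (norm_pos_iff.2 hi) 2⟩
  have hdens : IsDensity (pureState ((((√r)⁻¹ : ℝ) : ℂ) • φ)) := by
    refine ⟨posSemidef_pureState _, ?_⟩
    rw [trace_pureState]
    simp only [Pi.smul_apply, norm_smul, mul_pow, ← Finset.mul_sum, ← hr, Complex.norm_real,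
      Real.norm_eq_abs, sq_abs, inv_pow, Real.sq_sqrt hr0.le, inv_mul_cancel₀ hr0.ne',
      Complex.ofReal_one]
  have heq : pureState ((((√r)⁻¹ : ℝ) : ℂ) • φ) = pureState ψ := by
    refine tendsto_nhds_unique (tendsto_const_nhds (f := atTop)) ((hlim _ hdens 0).congr ?_)
    exact fun k => propagator_eq_self (hEφ _) 0 k
  rw [← heq, pureState_smul]
  -- The scalar equals one: `r⁻¹ |φ⟩⟨φ|` maps `φ` to itself.
  refine ⟨((√r ^ 2 / r : ℝ) : ℂ) • φ, ?_⟩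
  have hφφ : star φ ⬝ᵥ φ = (r : ℂ) := by
    have := trace_pureState φ
    rwa [pureState, trace_vecMulVec, dotProduct_comm] at this
  have hrc : (r : ℂ) ≠ 0 := by exact_mod_cast hr0.ne'
  rw [mulVecLin_apply, smul_mulVec, mulVec_smul, pureState, vecMulVec_mulVec, hφφ,
    Complex.norm_real, Real.norm_eq_abs, sq_abs, inv_pow, Real.sq_sqrt hr0.le]
  ext x
  simp only [Pi.smul_apply, Complex.real_smul, smul_eq_mul, MulOpposite.smul_eq_mul_unop,
    MulOpposite.unop_op]
  push_cast
  field_simp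

theorem isQLS_of_iInf_le {K : ℕ} (hK : 0 < K) {N : Fin K → Finset (Fin n)}
    {ψ : Config d → ℂ} (hψ : ∑ x, ‖ψ x‖ ^ 2 = 1)
    (h : ⨅ j, extendSubspace (N j) (supp (reducedState (N j) (pureState ψ))) ≤
      supp (pureState ψ)) : IsQLS N (pureState ψ) := by
  have hψ0 : ψ ≠ 0 := by
    rintro rfl
    simp at hψ
  -- A basis label exists because `ψ ≠ 0`; hence no local dimension is zero and `r j` is a genuine
  -- inverse.
  obtain ⟨c, -⟩ := Function.ne_iff.1 hψ0
  choose P hPH hPP hP using fun j =>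
    exists_orthogonal_projection (supp (reducedState (N j) (pureState ψ)))
  let A : ∀ j, InConfig d (N j) × InConfig d (N j) →
      Matrix (InConfig d (N j)) (InConfig d (N j)) ℂ := fun j ab =>
    single ab.1 ab.2 1 * (1 - P j)
  -- This weight offsets the sum over `a`, so the Kraus operators for failure sum to `1 - P j`.
  let r : Fin K → ℝ := fun j => (Fintype.card (InConfig d (N j)) : ℝ)⁻¹
  have hcard : ∀ j, 0 < (Fintype.card (InConfig d (N j)) : ℝ) := fun j => by
    have : Nonempty (InConfig d (N j)) := ⟨(split d (N j) c).1⟩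
    exact_mod_cast Fintype.card_pos
  have hr : ∀ j, 0 < r j := fun j => inv_pos.2 (hcard j)
  let F : Fin K → Matrix (Config d) (Config d) ℂ →ₗ[ℂ] Matrix (Config d) (Config d) ℂ := fun j =>
    coolMap (localOp (N j) (P j)) (fun ab => localOp (N j) (A j ab)) (r j)
  have hPψ : ∀ j o, P j *ᵥ block (N j) ψ o = block (N j) ψ o := fun j o => by
    rw [hP, supp_reducedState]
    exact Submodule.subset_span ⟨o, rfl⟩
  have hlocP : ∀ j, localOp (N j) (P j) *ᵥ ψ = ψ := fun j => by
    ext x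
    rw [localOp_mulVec, hPψ]
    simp [block]
  have hlocA : ∀ j ab, localOp (N j) (A j ab) *ᵥ ψ = 0 := fun j ab => by
    ext x
    rw [localOp_mulVec, ← mulVec_mulVec, sub_mulVec, hPψ, one_mulVec, sub_self, mulVec_zero]
    rfl
  have hlocPH : ∀ j, (localOp (N j) (P j))ᴴ *ᵥ ψ = ψ := fun j => by
    rw [localOp_conjTranspose, hPH, hlocP]
  have hkraus : ∀ j, (P j)ᴴ * P j + r j • ∑ ab, (A j ab)ᴴ * A j ab = 1 := fun j => by
    have hcr : (r j : ℂ) * (Fintype.card (InConfig d (N j)) : ℂ) = 1 := by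
      have := inv_mul_cancel₀ (hcard j).ne'
      exact_mod_cast congrArg (fun x : ℝ => (x : ℂ)) this
    rw [sum_single_mul (hPH j) (hPP j), hPH, hPP, ← Complex.coe_smul, smul_smul, hcr, one_smul,
      add_sub_cancel]
  have hext : ∀ j X, F j X = extendMap (N j) (coolMap (P j) (A j) (r j)) X := fun j X =>
    (extendMap_coolMap (N j) (P j) (A j) (r j) X).symm
  have htr : ∀ j X, (F j X).trace = X.trace := fun j X => by
    rw [hext]
    exact trace_extendMap (N j) (trace_coolMap (hkraus j)) X
  let ix : ℕ → Fin K := fun t => ⟨t % K, Nat.mod_lt t hK⟩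
  have hfix : ∀ t, F (ix t) (pureState ψ) = pureState ψ := fun t =>
    coolMap_pureState _ (hlocP _) (hlocA _)
  refine ⟨fun t => F (ix t), fun t => ⟨isCPTP_coolMap (hr _).le (htr _), ix t, _, hext _⟩,
    fun s k => propagator_eq_self hfix s k, fun σ hσ s => ?_⟩
  refine tendsto_propagator hψ hK
    (A := fun t => Set.range fun ab => localOp (N (ix t)) (A (ix t) ab)) (fun t => ?_)
    (fun t => isPositive_coolMap _ _ (hr _).le) (fun t => htr _)
    (fun t X hX => le_fidelity_coolMap _ (hr _).le (hlocPH _) hX)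
    (fun t X hX => dominates_coolMap _ _ (hr _).le hX) ?_ ?_ hσ s
  · exact congrArg F (Fin.ext (Nat.add_mod_right t K))
  · rintro t _ ⟨ab, rfl⟩ X hX
    exact dominates_coolMap_kraus _ _ (hr _) hX ab
  · intro W hW hψW
    refine eq_bot_of_invariant hψ0 h (Q := fun j => 1 - P j) (fun j u hu => ?_)
      (fun j a b w hw => ?_) hψW
    · rw [sub_mulVec, one_mulVec, sub_eq_zero] at hu
      exact (hP j u).1 hu.symm
    · have hj : ix j = j := Fin.ext (Nat.mod_eq_of_lt j.2)
      refine hW j j.2 _ ?_ w hw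
      rw [hj]
      exact ⟨(a, b), rfl⟩

end Stabilization

end QLS

end

theorem mainTheorem3 {n K : ℕ} (hK : 0 < K) (d : Fin n → ℕ) (N : Fin K → Finset (Fin n))
    (ψ : QLS.Config d → ℂ) (hψ : ∑ x, ‖ψ x‖ ^ 2 = 1) :
    QLS.IsQLS N (QLS.pureState ψ) ↔
      QLS.supp (QLS.pureState ψ) =
        ⨅ j, QLS.extendSubspace (N j) (QLS.supp (QLS.reducedState (N j) (QLS.pureState ψ))) :=
  ⟨fun h => le_antisymm
      (le_iInf fun j => QLS.supp_pureState_le_extendSubspace (N j) ψ) h.iInf_le,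
    fun h => QLS.isQLS_of_iInf_le hK hψ h.ge⟩
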